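/- Let $P$ be a simple polygon in the Euclidean plane, that is, the closed region consisting of a simple closed polygonal chain $\partial P$ with at least three vertices together with the points enclosed by $\partial P$. Two points of $P$ see each other if the line segment connecting them does not meet the exterior of $P$. Let $X_1$ and $X_2$ be two tours in $P$, that is, two closed curves contained in $P$ (in particular, closed polygonal cycles, which may be single points). If every point of $\partial P$ sees some point of $X_1$ or some point of $X_2$, then every point of $P$ sees some point of $X_1$ or some point of $X_2$. -/

import Mathlib

/-- The Euclidean plane. -/
abbrev Plane : Type := EuclideanSpace ℝ (Fin 2)

namespace Polygon

/-- A closed polygonal chain in the plane is simple if it has at least three vertices, the vertices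
are pairwise distinct, and two different edges meet at most in a common endpoint. -/
def IsSimple {n : ℕ} (P : Polygon Plane n) : Prop :=
  3 ≤ n ∧ Function.Injective P.vertices ∧
    ∀ i j : Fin n, i ≠ j →
      P.edgeSet ℝ i ∩ P.edgeSet ℝ j ⊆ {P i, P (finRotate n i)} ∩ {P j, P (finRotate n j)}

/-- The points that the boundary chain encloses: those off the chain whose connected component
in the complement of the chain is bounded. -/
def inside {n : ℕ} (P : Polygon Plane n) : Set Plane :=
  {x | x ∉ P.boundary ℝ ∧ Bornology.IsBounded (connectedComponentIn (P.boundary ℝ)ᶜ x)}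

/-- The polygon as a closed region of the plane: the boundary chain with all that it encloses. -/
def region {n : ℕ} (P : Polygon Plane n) : Set Plane :=
  P.boundary ℝ ∪ P.inside

/-- The exterior of the polygon. -/
def exterior {n : ℕ} (P : Polygon Plane n) : Set Plane :=
  P.regionᶜ

/-- Two points of the polygon see each other if the segment that connects them does not meet
the exterior of the polygon. -/
def Sees {n : ℕ} (P : Polygon Plane n) (x y : Plane) : Prop :=
  x ∈ P.region ∧ y ∈ P.region ∧ Disjoint (segment ℝ x y) P.exterior

/-- The weak visibility polygon of a set `X`: the points of the polygon that see some point
of `X`. -/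
def visibility {n : ℕ} (P : Polygon Plane n) (X : Set Plane) : Set Plane :=
  {x | x ∈ P.region ∧ ∃ y ∈ X, P.Sees x y}

end Polygon

/-! Suppose a point `p` off the boundary sees neither tour, and place it at the origin. The region
`R` has connected complement, so it has no holes. Hence a connected set `X` in `R` that is invisible
from the origin can be seen from the visible area only through one window: every sight line from a
visible point to `X` crosses one fixed open ray from the origin, towards one fixed side of its line
(`exists_window`). A visible point strictly on that side therefore does not see `X`.

Each tour thus forbids an open half-plane of directions. If the two window rays are not parallel,
the half-planes overlap, and a ray from `p` in a common direction ends at a visible boundary point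
that sees neither tour. If they are parallel, directions in the first half-plane that tend to the
opposite of the second window give boundary points seeing the second tour across that window; by
compactness, a limiting sight line passes through `p`, which therefore sees that tour
(`exists_visible_of_forall_pos`).

The absence of holes enters through logarithms: for `e`, `e'` off `R`, the quotient `(x - e) / (x -
e')` has a continuous logarithm on `R`. Two connections in `R` across the line `e e'`, one between
`e` and `e'` and one outside, would make its change ambiguous by `2π`
(`not_opposite_of_isPreconnected`). -/

open Bornology

/-! ### Bounded sets with their holes filled: closed, bounded, with connected complement. -/

section Filling

variable {E : Type*} [NormedAddCommGroup E]

/-- A set together with the bounded components of its complement. -/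
def filling (B : Set E) : Set E :=
  B ∪ {x | x ∉ B ∧ IsBounded (connectedComponentIn Bᶜ x)}

theorem notMem_filling_iff {B : Set E} {x : E} :
    x ∉ filling B ↔ x ∉ B ∧ ¬ IsBounded (connectedComponentIn Bᶜ x) := by
  simp only [filling, Set.mem_union, Set.mem_ofPred_eq]
  tauto

theorem connectedComponentIn_subset_compl_filling {B : Set E} {x : E} (hx : x ∉ filling B) :
    connectedComponentIn Bᶜ x ⊆ (filling B)ᶜ := by
  intro y hy
  rw [Set.mem_compl_iff, notMem_filling_iff, ← connectedComponentIn_eq hy]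
  exact ⟨connectedComponentIn_subset _ _ hy, (notMem_filling_iff.1 hx).2⟩

variable [NormedSpace ℝ E]

theorem isClosed_filling {B : Set E} (hB : IsClosed B) : IsClosed (filling B) := by
  rw [← isOpen_compl_iff, isOpen_iff_mem_nhds]
  intro x hx
  exact Filter.mem_of_superset
    (connectedComponentIn_mem_nhds (hB.isOpen_compl.mem_nhds (notMem_filling_iff.1 hx).1))
    (connectedComponentIn_subset_compl_filling hx)

theorem not_isBounded_ray {p d : E} (hd : d ≠ 0) (a : ℝ) :
    ¬ IsBounded ((fun t : ℝ => p + t • d) '' Set.Ici a) := by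
  intro h
  obtain ⟨C, hC⟩ := isBounded_iff_forall_norm_le.1 h
  have hd' : 0 < ‖d‖ := norm_pos_iff.2 hd
  set t : ℝ := max (max a 0) ((C + ‖p‖ + 1) / ‖d‖) with ht
  have h1 := hC _ ⟨t, by simp [ht], rfl⟩
  have h2 : C + ‖p‖ + 1 ≤ t * ‖d‖ := by
    rw [← div_le_iff₀ hd']
    exact le_max_right _ _
  have h3 : ‖t • d‖ ≤ ‖p + t • d‖ + ‖p‖ := by
    simpa using norm_sub_le (p + t • d) p
  have ht0 : 0 ≤ t := (le_max_right a 0).trans (le_max_left _ _)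
  rw [norm_smul, Real.norm_of_nonneg ht0] at h3
  linarith

theorem isPreconnected_ray (p d : E) (a : ℝ) :
    IsPreconnected ((fun t : ℝ => p + t • d) '' Set.Ici a) :=
  isPreconnected_Ici.image _ (by fun_prop)

/-- From a point off the ball the radial ray outwards never meets `B`, so the component of that
point is unbounded. -/
theorem filling_subset_closedBall {B : Set E} {r : ℝ} (hr : 0 ≤ r)
    (hB : B ⊆ Metric.closedBall 0 r) : filling B ⊆ Metric.closedBall 0 r := by
  intro x hx
  by_contra hxr
  have hxr' : r < ‖x‖ := by simpa using hxr
  have hx0 : x ≠ 0 := by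
    rintro rfl
    simp at hxr'
    linarith
  refine notMem_filling_iff.2 ⟨fun h => hxr (hB h), fun h => ?_⟩ hx
  refine not_isBounded_ray (p := x) hx0 0 (h.subset ?_)
  refine (isPreconnected_ray x x 0).subset_connectedComponentIn ⟨0, by simp⟩ ?_
  rintro _ ⟨t, ht, rfl⟩ hmem
  have h1 := hB hmem
  have ht : (0 : ℝ) ≤ t := ht
  have h2 : x + t • x = (1 + t) • x := by rw [add_smul, one_smul]
  rw [mem_closedBall_zero_iff] at h1
  simp only [h2, norm_smul, Real.norm_of_nonneg (by linarith : (0 : ℝ) ≤ 1 + t)] at h1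
  nlinarith

theorem isBounded_filling {B : Set E} (hB : IsBounded B) : IsBounded (filling B) := by
  obtain ⟨r, hr⟩ := hB.subset_closedBall 0
  refine Metric.isBounded_closedBall.subset (filling_subset_closedBall (le_max_right r 0)
    (hr.trans (Metric.closedBall_subset_closedBall (le_max_left r 0))))

/-- Every ray from a point of the filling off the set itself hits the set at a point that is
visible from the origin of the ray. -/
theorem exists_smul_mem_of_mem_filling {B : Set E} (hB : IsClosed B) {p d : E}
    (hp : p ∈ filling B) (hpB : p ∉ B) (hd : d ≠ 0) :
    ∃ t : ℝ, 0 < t ∧ p + t • d ∈ B ∧ segment ℝ p (p + t • d) ⊆ filling B := by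
  have hbdd : IsBounded (connectedComponentIn Bᶜ p) := (hp.resolve_left hpB).2
  have hcont : Continuous fun t : ℝ => p + t • d := by fun_prop
  set T : Set ℝ := Set.Ici 0 ∩ (fun t : ℝ => p + t • d) ⁻¹' B with hT
  have hTc : IsClosed T := isClosed_Ici.inter (hB.preimage hcont)
  -- A ray that missed `B` would be an unbounded connected subset of the bounded component of `p`.
  have hTn : T.Nonempty := by
    by_contra hne
    refine not_isBounded_ray (p := p) hd 0 (hbdd.subset ?_)
    refine (isPreconnected_ray p d 0).subset_connectedComponentIn ⟨0, by simp⟩ ?_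
    rintro _ ⟨t, ht, rfl⟩ hmem
    exact hne ⟨t, ht, hmem⟩
  have hTb : BddBelow T := ⟨0, fun t ht => ht.1⟩
  have hmem := hTc.csInf_mem hTn hTb
  set s := sInf T with hs
  have hs0 : s ≠ 0 := by
    intro h
    have h2 := hmem.2
    rw [h] at h2
    simp at h2
    exact hpB h2
  have hspos : 0 < s := lt_of_le_of_ne hmem.1 hs0.symm
  have hIco : ∀ t ∈ Set.Ico 0 s, p + t • d ∈ connectedComponentIn Bᶜ p := by
    have : (fun t : ℝ => p + t • d) '' Set.Ico 0 s ⊆ connectedComponentIn Bᶜ p := by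
      refine (isPreconnected_Ico.image _ hcont.continuousOn).subset_connectedComponentIn
        ⟨0, by simpa using hspos⟩ ?_
      rintro _ ⟨t, ht, rfl⟩ hmem
      exact (csInf_le hTb ⟨ht.1, hmem⟩).not_gt ht.2
    exact fun t ht => this ⟨t, ht, rfl⟩
  refine ⟨s, hspos, hmem.2, ?_⟩
  rw [segment_eq_image']
  rintro _ ⟨θ, hθ, rfl⟩
  have h1 : p + θ • (p + s • d - p) = p + (θ * s) • d := by
    rw [add_sub_cancel_left, smul_smul]
  simp only [h1]
  rcases hθ.2.eq_or_lt with rfl | hlt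
  · rw [one_mul]
    exact Or.inl hmem.2
  · have h2 := hIco (θ * s) ⟨mul_nonneg hθ.1 hspos.le, by nlinarith⟩
    refine Or.inr ⟨connectedComponentIn_subset _ _ h2, ?_⟩
    rwa [← connectedComponentIn_eq h2]

theorem isPreconnected_compl_closedBall (h : 1 < Module.rank ℝ E) {r : ℝ} (hr : 0 ≤ r) :
    IsPreconnected (Metric.closedBall (0 : E) r)ᶜ := by
  have h1 : IsPreconnected ((fun q : ℝ × E => q.1 • q.2) ''
      (Set.Ioi r ×ˢ Metric.sphere (0 : E) 1)) :=
    (isPreconnected_Ioi.prod (isPreconnected_sphere h 0 1)).image _ (by fun_prop)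
  convert h1 using 1
  ext x
  simp only [Set.mem_compl_iff, mem_closedBall_zero_iff, not_le, Set.mem_image, Set.mem_prod,
    Set.mem_Ioi, mem_sphere_zero_iff_norm, Prod.exists]
  constructor
  · intro hx
    have : ‖x‖ ≠ 0 := by linarith
    exact ⟨‖x‖, ‖x‖⁻¹ • x, ⟨hx, by rw [norm_smul, norm_inv, norm_norm, inv_mul_cancel₀ this]⟩,
      by rw [smul_smul, mul_inv_cancel₀ this, one_smul]⟩
  · rintro ⟨a, y, ⟨ha, hy⟩, rfl⟩
    rw [norm_smul, hy, mul_one, Real.norm_of_nonneg (by linarith)]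
    exact ha

/-- Only unbounded components of the complement of `B` remain; each leaves a large ball around `B`,
and the outside of that ball is connected in dimension at least two. -/
theorem isPreconnected_compl_filling (h : 1 < Module.rank ℝ E) {B : Set E} (hB : IsBounded B) :
    IsPreconnected (filling B)ᶜ := by
  obtain ⟨r', hr'⟩ := hB.subset_closedBall 0
  set r := max r' 0
  have hr : B ⊆ Metric.closedBall 0 r :=
    hr'.trans (Metric.closedBall_subset_closedBall (le_max_left _ _))
  have hr0 : 0 ≤ r := le_max_right _ _
  have hsub : (Metric.closedBall (0 : E) r)ᶜ ⊆ (filling B)ᶜ :=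
    Set.compl_subset_compl.2 (filling_subset_closedBall hr0 hr)
  have hcomp := isPreconnected_compl_closedBall (E := E) h hr0
  have key : ∀ x ∉ filling B, ∃ y ∈ connectedComponentIn Bᶜ x, y ∉ Metric.closedBall (0 : E) r := by
    intro x hx
    by_contra! hcon
    exact (notMem_filling_iff.1 hx).2 (Metric.isBounded_closedBall.subset hcon)
  refine isPreconnected_of_forall_pair fun x hx y hy => ?_
  obtain ⟨x', hx', hxr⟩ := key x hx
  obtain ⟨y', hy', hyr⟩ := key y hy
  refine ⟨connectedComponentIn Bᶜ x ∪ (Metric.closedBall (0 : E) r)ᶜ ∪ connectedComponentIn Bᶜ y,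
    ?_, ?_, ?_, ?_⟩
  · exact Set.union_subset (Set.union_subset (connectedComponentIn_subset_compl_filling hx) hsub)
      (connectedComponentIn_subset_compl_filling hy)
  · exact Or.inl (Or.inl (mem_connectedComponentIn (notMem_filling_iff.1 hx).1))
  · exact Or.inr (mem_connectedComponentIn (notMem_filling_iff.1 hy).1)
  · exact IsPreconnected.union y' (Or.inr hyr) hy'
      (IsPreconnected.union x' hx' hxr isPreconnected_connectedComponentIn hcomp)
      isPreconnected_connectedComponentIn

end Filling

/-! ### Continuous logarithms and a separation argument in the plane. -/

section LogRatio

open Complex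

/-- The planar planarCross product. -/
def planarCross (a b : ℂ) : ℝ := a.re * b.im - a.im * b.re

/-- The difference of two logarithms of the same function is continuous with values in `2πiℤ`, hence
locally constant. -/
theorem IsPreconnected.sub_eq_sub_of_exp_eq {S : Set ℂ} (hS : IsPreconnected S) {f g : ℂ → ℂ}
    (hf : ContinuousOn f S) (hg : ContinuousOn g S) (h : ∀ x ∈ S, exp (f x) = exp (g x))
    {x y : ℂ} (hx : x ∈ S) (hy : y ∈ S) : f x - g x = f y - g y := by
  refine hS.induction₂ (fun x y => f x - g x = f y - g y) ?_ (fun _ _ _ _ _ _ => Eq.trans)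
    (fun _ _ _ _ => Eq.symm) hx hy
  intro x hx
  have hc : ContinuousWithinAt (fun y => f y - g y) S x := (hf.sub hg) x hx
  filter_upwards [hc (Metric.ball_mem_nhds _ one_pos), self_mem_nhdsWithin] with y hy hyS
  have h1 : exp ((f y - g y) - (f x - g x)) = 1 := by
    rw [exp_sub, exp_sub, exp_sub, h x hx, h y hyS]
    simp
  obtain ⟨n, hn⟩ := exp_eq_one_iff.1 h1
  have h2 : ‖(f y - g y) - (f x - g x)‖ < 1 := by simpa [dist_eq_norm] using hy
  have h3 : n = 0 := by
    by_contra hn0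
    have h4 : (1 : ℝ) ≤ |(n : ℝ)| := by exact_mod_cast Int.one_le_abs hn0
    have h5 : ‖(n : ℂ) * (2 * Real.pi * I)‖ = |(n : ℝ)| * (2 * Real.pi) := by
      simp [abs_of_pos Real.pi_pos]
    rw [hn, h5] at h2
    nlinarith [Real.pi_gt_three]
  rw [h3] at hn
  simp only [Int.cast_zero, zero_mul] at hn
  exact (sub_eq_zero.1 hn).symm

/-- If the complement of a closed set `R` in the plane is connected, then for `e` and `e'` off `R`
the ratio `(x - e) / (x - e')` has a continuous logarithm on `R`. -/
theorem exists_continuousOn_log_div {R : Set ℂ} (hR : IsClosed R) (hRc : IsPreconnected Rᶜ)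
    {e e' : ℂ} (he : e ∉ R) (he' : e' ∉ R) :
    ∃ D : ℂ → ℂ, ContinuousOn D R ∧ ∀ x ∈ R, exp (D x) = (x - e) / (x - e') := by
  have hne : ∀ {a x : ℂ}, a ∈ Rᶜ → x ∈ R → x - a ≠ 0 := by
    intro a x ha hx h
    exact ha (sub_eq_zero.1 h ▸ hx)
  -- Having a logarithm of the quotient is symmetric and transitive in the pair of poles, so on the
  -- connected complement it suffices to treat nearby poles.
  refine hRc.induction₂
    (fun e e' => ∃ D : ℂ → ℂ, ContinuousOn D R ∧ ∀ x ∈ R, exp (D x) = (x - e) / (x - e'))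
    ?_ ?_ ?_ (x := e) (y := e') he he'
  · intro a ha
    obtain ⟨δ, hδ, hball⟩ := Metric.isOpen_iff.1 hR.isOpen_compl a ha
    have hfar : ∀ x ∈ R, δ ≤ ‖x - a‖ := by
      intro x hx
      by_contra! hlt
      exact hball (by simpa [dist_eq_norm] using hlt) hx
    filter_upwards [mem_nhdsWithin_of_mem_nhds (Metric.ball_mem_nhds a hδ),
      self_mem_nhdsWithin] with b hb hbR
    have hb' : ‖b - a‖ < δ := by simpa [dist_eq_norm] using hb
    -- As `b` is closer to `a` than any point of `R`, the quotient lies within distance less than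
    -- `1` of `1`, and the principal logarithm serves.
    have hslit : ∀ x ∈ R, (x - b) / (x - a) ∈ slitPlane := by
      intro x hx
      have h1 : (x - b) / (x - a) = 1 + -((b - a) / (x - a)) := by
        field_simp [hne ha hx]
        ring
      rw [h1]
      apply mem_slitPlane_of_norm_lt_one
      rw [norm_neg, norm_div, div_lt_one (norm_pos_iff.2 (hne ha hx))]
      exact hb'.trans_le (hfar x hx)
    refine ⟨fun x => - log ((x - b) / (x - a)), ?_, ?_⟩
    · refine (ContinuousOn.clog (ContinuousOn.div (by fun_prop) (by fun_prop)
        fun x hx => hne ha hx) hslit).neg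
    · intro x hx
      rw [exp_neg, exp_log (slitPlane_ne_zero (hslit x hx)), inv_div]
  · rintro a b c ha hb hc ⟨D, hD, hD'⟩ ⟨F, hF, hF'⟩
    refine ⟨fun x => D x + F x, hD.add hF, fun x hx => ?_⟩
    rw [exp_add, hD' x hx, hF' x hx]
    field_simp [hne hb hx, hne hc hx]
  · rintro a b ha hb ⟨D, hD, hD'⟩
    refine ⟨fun x => - D x, hD.neg, fun x hx => ?_⟩
    rw [exp_neg, hD' x hx, inv_div]

theorem eq_smul_of_cross_eq_zero {m y : ℂ} (hm : m ≠ 0) (h : planarCross m y = 0) :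
    ∃ c : ℝ, y = c • m := by
  have hm' : m.re * m.re + m.im * m.im ≠ 0 := by
    simpa [normSq_apply] using (normSq_pos.2 hm).ne'
  refine ⟨(m.re * y.re + m.im * y.im) / (m.re * m.re + m.im * m.im), ?_⟩
  unfold planarCross at h
  apply Complex.ext
  · simp only [smul_re, smul_eq_mul]
    rw [div_mul_eq_mul_div, eq_div_iff hm']
    linear_combination (-m.im) * h
  · simp only [smul_im, smul_eq_mul]
    rw [div_mul_eq_mul_div, eq_div_iff hm']
    linear_combination m.re * h

/-- When `τ + τ' > 0`, the sign of the imaginary part of the quotient tells the side of the line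
through `m`. -/
theorem im_div_sub_smul (m y : ℂ) (τ τ' : ℝ) :
    ((y - τ • m) / (y - -τ' • m)).im = (τ + τ') * planarCross m y / normSq (y - -τ' • m) := by
  rw [div_im]
  simp only [planarCross, sub_re, sub_im, smul_re, smul_im, smul_eq_mul]
  ring

theorem smul_sub_div_smul_sub {m : ℂ} (hm : m ≠ 0) (c a b : ℝ) :
    (c • m - a • m) / (c • m - b • m) = (((c - a) / (c - b) : ℝ) : ℂ) := by
  rw [← sub_smul, ← sub_smul]
  simp only [real_smul]
  rw [mul_div_mul_right _ _ hm]
  push_cast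
  rfl

/-- Let `R` be a closed set with connected complement, and let two points of `R` on opposite sides
of a line be joined within `R` both by a connected set that avoids a segment of the line and by a
connected set that avoids the rest of the line. Then an endpoint of the segment lies in `R`. -/
theorem not_opposite_of_isPreconnected {R Y Q : Set ℂ} (hR : IsClosed R) (hRc : IsPreconnected Rᶜ)
    {m : ℂ} (hm : m ≠ 0) {τ τ' : ℝ} (hτ : 0 < τ) (hτ' : 0 < τ') (he : τ • m ∉ R)
    (he' : -τ' • m ∉ R) (hYR : Y ⊆ R) (hYc : IsPreconnected Y)
    (hY : ∀ t : ℝ, -τ' ≤ t → t ≤ τ → t • m ∉ Y) (hQR : Q ⊆ R) (hQc : IsPreconnected Q)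
    (hQ : ∀ t : ℝ, t • m ∈ Q → -τ' < t ∧ t < τ) {y z : ℂ} (hyY : y ∈ Y) (hzY : z ∈ Y)
    (hyQ : y ∈ Q) (hzQ : z ∈ Q) (hy : 0 < planarCross m y) (hz : planarCross m z < 0) : False := by
  obtain ⟨D, hD, hexp⟩ := exists_continuousOn_log_div hR hRc he he'
  set w : ℂ → ℂ := fun x => (x - τ • m) / (x - -τ' • m) with hw
  have hne : ∀ x ∈ R, x - -τ' • m ≠ 0 := fun x hx h => he' (sub_eq_zero.1 h ▸ hx)
  have hwc : ContinuousOn w R := ContinuousOn.div (by fun_prop) (by fun_prop) hne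
  have him : ∀ x ∈ R, planarCross m x ≠ 0 → (w x).im ≠ 0 := by
    intro x hx hc
    rw [hw]
    simp only [im_div_sub_smul]
    exact div_ne_zero (mul_ne_zero (by positivity) hc) (normSq_pos.2 (hne x hx)).ne'
  -- On the line the quotient `w` is real: positive outside the segment between the two poles,
  -- negative inside. So `w` avoids the cut on `Y`, and `-w` avoids it on `Q`.
  have hYs : ∀ x ∈ Y, w x ∈ slitPlane := by
    intro x hx
    rw [mem_slitPlane_iff]
    by_cases hc : planarCross m x = 0
    · left
      obtain ⟨c, rfl⟩ := eq_smul_of_cross_eq_zero hm hc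
      rw [hw]
      simp only [smul_sub_div_smul_sub hm, ofReal_re]
      rcases lt_or_ge c (-τ') with h | h
      · exact div_pos_of_neg_of_neg (by linarith) (by linarith)
      · have : τ < c := by
          by_contra! h2
          exact hY c h h2 hx
        exact div_pos (by linarith) (by linarith)
    · exact Or.inr (him x (hYR hx) hc)
  have hQs : ∀ x ∈ Q, -w x ∈ slitPlane := by
    intro x hx
    rw [mem_slitPlane_iff]
    by_cases hc : planarCross m x = 0
    · left
      obtain ⟨c, rfl⟩ := eq_smul_of_cross_eq_zero hm hc
      obtain ⟨h1, h2⟩ := hQ c hx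
      rw [hw]
      simp only [smul_sub_div_smul_sub hm, neg_re, ofReal_re]
      rw [← neg_div]
      exact div_pos (by linarith) (by linarith)
    · exact Or.inr (by simpa using him x (hQR hx) hc)
  have h1 := hYc.sub_eq_sub_of_exp_eq (hD.mono hYR) ((hwc.mono hYR).clog hYs)
    (fun x hx => by rw [hexp x (hYR hx), exp_log (slitPlane_ne_zero (hYs x hx))]) hyY hzY
  have h2 := hQc.sub_eq_sub_of_exp_eq (g := fun x => log (-w x) + Real.pi * I) (hD.mono hQR)
    (((hwc.mono hQR).neg.clog hQs).add continuousOn_const)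
    (fun x hx => by
      rw [hexp x (hQR hx), exp_add, exp_log (slitPlane_ne_zero (hQs x hx)), exp_pi_mul_I]
      simp [hw]) hyQ hzQ
  have hwy : 0 < (w y).im := by
    simp only [hw, im_div_sub_smul]
    exact div_pos (by positivity) (normSq_pos.2 (hne y (hYR hyY)))
  have hwz : (w z).im < 0 := by
    simp only [hw, im_div_sub_smul]
    exact div_neg_of_neg_of_pos (mul_neg_of_pos_of_neg (by positivity) hz)
      (normSq_pos.2 (hne z (hYR hzY)))
  -- Passing from `w` to `-w` lowers the argument at `y` by `π` and raises it at `z` by `π`, so the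
  -- two values for the change of `D` from `y` to `z` differ by `2π` in imaginary part.
  have h3 := congrArg im h1
  have h4 := congrArg im h2
  simp only [sub_im, add_im, log_im, arg_neg_eq_arg_sub_pi_of_im_pos hwy,
    arg_neg_eq_arg_add_pi_of_im_neg hwz] at h3 h4
  linarith [Real.pi_pos]

end LogRatio

/-! ### Visibility from the origin along rays and segments. -/

section Segments

variable {E : Type*} [NormedAddCommGroup E] [NormedSpace ℝ E] {R : Set E}

theorem smul_mem_segment_smul {a b k : ℝ} (hk : k ∈ Set.uIcc a b) (z : E) :
    k • z ∈ segment ℝ (a • z) (b • z) := by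
  rw [← segment_eq_uIcc] at hk
  obtain ⟨α, β, hα, hβ, hαβ, rfl⟩ := hk
  exact ⟨α, β, hα, hβ, hαβ, by simp only [smul_smul, add_smul, smul_eq_mul]⟩

theorem smul_mem_segment_zero_smul {k t : ℝ} (hk : 0 ≤ k) (hkt : k ≤ t) (z : E) :
    k • z ∈ segment ℝ 0 (t • z) := by
  simpa using smul_mem_segment_smul (a := 0) (b := t)
    (by rw [Set.uIcc_of_le (hk.trans hkt)]; exact ⟨hk, hkt⟩) z

theorem exists_smul_of_mem_segment_zero {z y : E} (hy : y ∈ segment ℝ 0 z) :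
    ∃ k : ℝ, 0 ≤ k ∧ k ≤ 1 ∧ y = k • z := by
  obtain ⟨α, β, hα, hβ, hαβ, rfl⟩ := hy
  exact ⟨β, hβ, by linarith, by simp⟩

theorem segment_subset_segment_of_mem {q x z : E} (hz : z ∈ segment ℝ q x) :
    segment ℝ z x ⊆ segment ℝ q x :=
  (convex_segment q x).segment_subset hz (right_mem_segment ℝ q x)

theorem isClosed_segment (x y : E) : IsClosed (segment ℝ x y) := by
  rw [segment_eq_image']
  exact (isCompact_Icc.image (by fun_prop)).isClosed

theorem isClosed_setOf_segment_subset (hR : IsClosed R) :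
    IsClosed {p : E × E | segment ℝ p.1 p.2 ⊆ R} := by
  have : {p : E × E | segment ℝ p.1 p.2 ⊆ R} =
      ⋂ θ ∈ Set.Icc (0 : ℝ) 1, (fun p : E × E => p.1 + θ • (p.2 - p.1)) ⁻¹' R := by
    ext p
    simp only [Set.mem_ofPred_eq, Set.mem_iInter, segment_eq_image', Set.image_subset_iff]
    rfl
  rw [this]
  exact isClosed_biInter fun θ _ => hR.preimage (by fun_prop)

theorem isClosed_setOf_segment_zero_subset (hR : IsClosed R) :
    IsClosed {x : E | segment ℝ 0 x ⊆ R} :=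
  (isClosed_setOf_segment_subset hR).preimage
    (by fun_prop : Continuous fun x : E => ((0 : E), x))

/-- On a ray from the origin there is a point off a bounded set `R` so close to the part visible
from the origin that a closed set disjoint from that part is not met before. -/
theorem exists_smul_notMem (hR : IsClosed R) (hRb : Bornology.IsBounded R) (h0 : 0 ∈ R)
    {C : Set E} (hC : IsClosed C) {d : E} (hd : d ≠ 0)
    (hdC : ∀ t : ℝ, 0 ≤ t → segment ℝ 0 (t • d) ⊆ R → t • d ∉ C) :
    ∃ τ : ℝ, 0 < τ ∧ τ • d ∉ R ∧ ∀ t : ℝ, 0 ≤ t → t ≤ τ → t • d ∉ C := by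
  set T : Set ℝ := Set.Ici 0 ∩ (fun t : ℝ => t • d) ⁻¹' {x : E | segment ℝ 0 x ⊆ R} with hT
  have hcont : Continuous fun t : ℝ => t • d := by fun_prop
  have hTc : IsClosed T :=
    isClosed_Ici.inter ((isClosed_setOf_segment_zero_subset hR).preimage hcont)
  have hT0 : (0 : ℝ) ∈ T := ⟨Set.self_mem_Ici, by simpa using h0⟩
  have hTb : BddAbove T := by
    obtain ⟨c, hc⟩ := isBounded_iff_forall_norm_le.1 hRb
    refine ⟨c / ‖d‖, fun t ht => ?_⟩
    rw [le_div_iff₀ (norm_pos_iff.2 hd)]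
    have := hc _ (ht.2 (right_mem_segment ℝ 0 (t • d)))
    rwa [norm_smul, Real.norm_of_nonneg ht.1] at this
  have hr := hTc.csSup_mem ⟨0, hT0⟩ hTb
  set r := sSup T with hrdef
  obtain ⟨ε, hε, hball⟩ := Metric.isOpen_iff.1 (hC.isOpen_compl.preimage hcont) r
    (hdC r hr.1 hr.2)
  have hr0 : 0 ≤ r := hr.1
  -- The visible part of the ray ends at `r`, so `R` is left somewhere in `(r, r + ε / 2]`, while
  -- `C` is still avoided there.
  have hnot : r + ε / 2 ∉ T := fun h => by linarith [le_csSup hTb h]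
  have : ¬ segment ℝ 0 ((r + ε / 2) • d) ⊆ R := fun h =>
    hnot ⟨show (0 : ℝ) ≤ _ by positivity, h⟩
  obtain ⟨y, hy, hyR⟩ := Set.not_subset.1 this
  obtain ⟨k, hk0, hk1, rfl⟩ := exists_smul_of_mem_segment_zero hy
  rw [smul_smul] at hyR
  have hlt : r < k * (r + ε / 2) := by
    by_contra! hle
    exact hyR (hr.2 (smul_mem_segment_zero_smul (by positivity) hle d))
  refine ⟨k * (r + ε / 2), by linarith, hyR, fun t ht0 ht => ?_⟩
  rcases le_or_gt t r with h | h
  · refine hdC t ht0 (Set.Subset.trans ?_ hr.2)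
    exact (convex_segment _ _).segment_subset (left_mem_segment ℝ _ _)
      (smul_mem_segment_zero_smul ht0 h d)
  · refine hball ?_
    rw [Metric.mem_ball, Real.dist_eq, abs_lt]
    constructor <;> nlinarith

/-- From `z` on, the sight line to `x` is invisible from the origin, so appending it to an invisible
set adds only the one visible point `z`. -/
theorem exists_last_visible (hR : IsClosed R) {q x : E} (hq : segment ℝ 0 q ⊆ R) :
    ∃ z ∈ segment ℝ q x, segment ℝ 0 z ⊆ R ∧
      ∀ y ∈ segment ℝ z x, segment ℝ 0 y ⊆ R → y = z := by
  set T : Set ℝ := Set.Icc 0 1 ∩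
    (fun θ : ℝ => q + θ • (x - q)) ⁻¹' {x : E | segment ℝ 0 x ⊆ R} with hT
  have hTc : IsCompact T := isCompact_Icc.inter_right
    ((isClosed_setOf_segment_zero_subset hR).preimage (by fun_prop))
  obtain ⟨θ, hθ, hmax⟩ := hTc.exists_isGreatest ⟨0, by simp, by simpa using hq⟩
  refine ⟨q + θ • (x - q), ?_, hθ.2, ?_⟩
  · rw [segment_eq_image']
    exact ⟨θ, hθ.1, rfl⟩
  · intro y hy hyR
    rw [segment_eq_image'] at hy
    obtain ⟨μ, hμ, rfl⟩ := hy
    have h1 : q + θ • (x - q) + μ • (x - (q + θ • (x - q))) =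
        q + (θ + μ * (1 - θ)) • (x - q) := by module
    simp only [h1] at hyR ⊢
    obtain ⟨hθ0, hθ1⟩ := hθ.1
    obtain ⟨hμ0, hμ1⟩ := hμ
    have h2 : 0 ≤ μ * (1 - θ) := mul_nonneg hμ0 (by linarith)
    have h3 := hmax ⟨⟨by linarith, by nlinarith⟩, hyR⟩
    have h4 : μ * (1 - θ) = 0 := by linarith
    rw [h4, add_zero]

end Segments

/-! ### The window through which an invisible connected set is seen. -/

section Window

variable {R X : Set ℂ}

theorem planarCross_add_smul (m x y : ℂ) (a b : ℝ) :
    planarCross m (a • x + b • y) = a * planarCross m x + b * planarCross m y := by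
  simp [planarCross]
  ring

theorem planarCross_smul (m x : ℂ) (a : ℝ) : planarCross m (a • x) = a * planarCross m x := by
  simp [planarCross]
  ring

theorem planarCross_self (m : ℂ) : planarCross m m = 0 := by
  simp [planarCross]
  ring

theorem exists_cross_pos_neg {z z' : ℂ} (hz : z ≠ 0) (hz' : z' ≠ 0)
    (h : ∀ c : ℝ, 0 < c → z' ≠ c • z) : ∃ m : ℂ, 0 < planarCross m z ∧ planarCross m z' < 0 := by
  have ha : 0 < ‖z‖ := norm_pos_iff.2 hz
  have hb : 0 < ‖z'‖ := norm_pos_iff.2 hz'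
  have hne : ‖z'‖ • z ≠ ‖z‖ • z' := by
    intro heq
    refine h (‖z'‖ / ‖z‖) (by positivity) ?_
    rw [div_eq_inv_mul, mul_smul, heq, smul_smul, inv_mul_cancel₀ ha.ne', one_smul]
  have hlt := inner_lt_norm_mul_iff_real.2 hne
  have hin : inner ℝ z z' = z.re * z'.re + z.im * z'.im := by
    rw [Complex.inner]
    simp
    ring
  rw [hin] at hlt
  have hz2 : ‖z‖ * ‖z‖ = z.re * z.re + z.im * z.im := by
    rw [Complex.norm_mul_self_eq_normSq, Complex.normSq_apply]
  have hz2' : ‖z'‖ * ‖z'‖ = z'.re * z'.re + z'.im * z'.im := by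
    rw [Complex.norm_mul_self_eq_normSq, Complex.normSq_apply]
  -- The witness is `‖z‖ • z' - ‖z'‖ • z` turned by a right angle; it spans the bisector of the
  -- angle between `z` and `z'`, and the signs come from strict Cauchy–Schwarz.
  refine ⟨⟨-(‖z‖ * z'.im - ‖z'‖ * z.im), ‖z‖ * z'.re - ‖z'‖ * z.re⟩, ?_, ?_⟩
  · have : planarCross ⟨-(‖z‖ * z'.im - ‖z'‖ * z.im), ‖z‖ * z'.re - ‖z'‖ * z.re⟩ z =
        ‖z‖ * (‖z‖ * ‖z'‖ - (z.re * z'.re + z.im * z'.im)) := by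
      simp only [planarCross]
      linear_combination (-‖z'‖) * hz2
    rw [this]
    exact mul_pos ha (by linarith)
  · have : planarCross ⟨-(‖z‖ * z'.im - ‖z'‖ * z.im), ‖z‖ * z'.re - ‖z'‖ * z.re⟩ z' =
        - (‖z'‖ * (‖z‖ * ‖z'‖ - (z.re * z'.re + z.im * z'.im))) := by
      simp only [planarCross]
      linear_combination ‖z‖ * hz2'
    rw [this, neg_lt_zero]
    exact mul_pos hb (by linarith)

theorem ne_zero_of_cross_ne_zero {m z : ℂ} (h : planarCross m z ≠ 0) : m ≠ 0 := by
  rintro rfl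
  simp [planarCross] at h

/-- On a common line through the origin, the segments from `0` to `z` and from `z` to `x` cover the
one from `0` to `x`. This keeps seen points of an invisible set off the line of the window. -/
theorem segment_zero_subset_of_cross_eq_zero {z x : ℂ} (hz : segment ℝ 0 z ⊆ R)
    (hzx : segment ℝ z x ⊆ R) (h : planarCross z x = 0) : segment ℝ 0 x ⊆ R := by
  by_cases hz0 : z = 0
  · rwa [hz0] at hzx
  obtain ⟨c, rfl⟩ := eq_smul_of_cross_eq_zero hz0 h
  intro y hy
  obtain ⟨k, hk0, hk1, rfl⟩ := exists_smul_of_mem_segment_zero hy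
  rw [smul_smul]
  by_cases hk : 0 ≤ k * c ∧ k * c ≤ 1
  · apply hz
    simpa using smul_mem_segment_zero_smul hk.1 hk.2 z
  · apply hzx
    have : k * c ∈ Set.uIcc 1 c := by
      rw [Set.mem_uIcc]
      by_cases h1 : 0 ≤ k * c
      · left
        have h2 : 1 < k * c := by
          by_contra! h3
          exact hk ⟨h1, h3⟩
        have h4 : 0 ≤ c := by
          by_contra! h4
          linarith [mul_nonpos_of_nonneg_of_nonpos hk0 h4.le]
        exact ⟨h2.le, mul_le_of_le_one_left h4 hk1⟩
      · right
        have h4 : c ≤ 0 := by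
          by_contra! h4
          exact h1 (mul_nonneg hk0 h4.le)
        constructor <;> nlinarith
    simpa using smul_mem_segment_smul this z

/-- The points where a connected invisible set is first seen lie on a single ray. -/
theorem eq_smul_of_last_visible (hR : IsClosed R) (hRb : Bornology.IsBounded R)
    (hRc : IsPreconnected Rᶜ) (h0 : 0 ∈ R) (hX : IsClosed X) (hXc : IsPreconnected X)
    (hXR : X ⊆ R) (hXv : ∀ x ∈ X, ¬ segment ℝ 0 x ⊆ R) {x x' z z' : ℂ} (hx : x ∈ X)
    (hx' : x' ∈ X) (hz : segment ℝ 0 z ⊆ R) (hz' : segment ℝ 0 z' ⊆ R)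
    (hzx : segment ℝ z x ⊆ R) (hzx' : segment ℝ z' x' ⊆ R)
    (hlast : ∀ y ∈ segment ℝ z x, segment ℝ 0 y ⊆ R → y = z)
    (hlast' : ∀ y ∈ segment ℝ z' x', segment ℝ 0 y ⊆ R → y = z') :
    ∃ c : ℝ, 0 < c ∧ z' = c • z := by
  by_contra! hcon
  have hz0 : z ≠ 0 := by
    rintro rfl
    exact hXv x hx hzx
  have hz0' : z' ≠ 0 := by
    rintro rfl
    exact hXv x' hx' hzx'
  obtain ⟨m, hmz, hmz'⟩ := exists_cross_pos_neg hz0 hz0' hcon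
  have hm := ne_zero_of_cross_ne_zero hmz.ne'
  -- A line through the origin separates `z` from `z'`. They are joined through `X` by `Y`, which
  -- avoids the visible part of the line, and through the origin by two segments that meet the line
  -- only there.
  set Y := segment ℝ z x ∪ X ∪ segment ℝ z' x' with hYdef
  have hYcl : IsClosed Y := ((isClosed_segment z x).union hX).union (isClosed_segment z' x')
  have hYc : IsPreconnected Y := by
    refine IsPreconnected.union x' (Or.inr hx') (right_mem_segment ℝ _ _) ?_
      (convex_segment _ _).isPreconnected
    exact IsPreconnected.union x (right_mem_segment ℝ _ _) hx
      (convex_segment _ _).isPreconnected hXc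
  have hYR : Y ⊆ R := Set.union_subset (Set.union_subset hzx hXR) hzx'
  have hYV : ∀ k : ℝ, segment ℝ 0 (k • m) ⊆ R → k • m ∉ Y := by
    intro k hk hkY
    have hzero : planarCross m (k • m) = 0 := by rw [planarCross_smul, planarCross_self, mul_zero]
    rcases hkY with (h | h) | h
    · rw [hlast _ h hk] at hzero
      exact hmz.ne' hzero
    · exact hXv _ h hk
    · rw [hlast' _ h hk] at hzero
      exact hmz'.ne hzero
  obtain ⟨τ, hτ, hτR, hτY⟩ := exists_smul_notMem hR hRb h0 hYcl hm fun t _ => hYV t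
  obtain ⟨τ', hτ', hτR', hτY'⟩ := exists_smul_notMem hR hRb h0 hYcl (neg_ne_zero.2 hm)
    fun t _ => by
      rw [smul_neg, ← neg_smul]
      exact hYV (-t)
  refine not_opposite_of_isPreconnected (Y := Y) (Q := segment ℝ 0 z ∪ segment ℝ 0 z')
    hR hRc hm hτ hτ' hτR (by rwa [neg_smul, ← smul_neg]) hYR hYc ?_ (Set.union_subset hz hz') ?_ ?_
    (Or.inl (Or.inl (left_mem_segment ℝ _ _))) (Or.inr (left_mem_segment ℝ _ _))
    (Or.inl (right_mem_segment ℝ _ _)) (Or.inr (right_mem_segment ℝ _ _)) hmz hmz'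
  · intro t ht1 ht2
    rcases le_total 0 t with h | h
    · exact hτY t h ht2
    · have := hτY' (-t) (by linarith) (by linarith)
      rwa [smul_neg, neg_smul, neg_neg] at this
  · exact IsPreconnected.union 0 (left_mem_segment ℝ _ _) (left_mem_segment ℝ _ _)
      (convex_segment _ _).isPreconnected (convex_segment _ _).isPreconnected
  · intro t ht
    have aux : ∀ w : ℂ, planarCross m w ≠ 0 → t • m ∈ segment ℝ 0 w → t = 0 := by
      intro w hw htw
      obtain ⟨k, -, -, hk⟩ := exists_smul_of_mem_segment_zero htw
      have h1 : k * planarCross m w = 0 := by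
        rw [← planarCross_smul, ← hk, planarCross_smul, planarCross_self, mul_zero]
      have h2 : k = 0 := (mul_eq_zero.1 h1).resolve_right hw
      rw [h2, zero_smul] at hk
      exact (smul_eq_zero.1 hk).resolve_right hm
    have : t = 0 := ht.elim (aux z hmz.ne') (aux z' hmz'.ne)
    rw [this]
    exact ⟨by linarith, hτ⟩

/-- A connected invisible set is seen through a ray from one side of the ray only. -/
theorem not_seen_from_both_sides (hR : IsClosed R) (hRb : Bornology.IsBounded R)
    (hRc : IsPreconnected Rᶜ) (h0 : 0 ∈ R) (hX : IsClosed X) (hXc : IsPreconnected X)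
    (hXR : X ⊆ R) (hXv : ∀ x ∈ X, ¬ segment ℝ 0 x ⊆ R) {x x' u : ℂ} {a b : ℝ} (hx : x ∈ X)
    (hx' : x' ∈ X) (ha : 0 ≤ a) (hb : 0 ≤ b) (hz : segment ℝ 0 (a • u) ⊆ R)
    (hz' : segment ℝ 0 (b • u) ⊆ R) (hzx : segment ℝ (a • u) x ⊆ R)
    (hzx' : segment ℝ (b • u) x' ⊆ R) (hxu : 0 < planarCross u x) (hxu' : planarCross u x' < 0) : False := by
  have hu := ne_zero_of_cross_ne_zero hxu.ne'
  have hXV : ∀ k : ℝ, segment ℝ 0 (k • u) ⊆ R → k • u ∉ X := fun k hk hkX => hXv _ hkX hk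
  obtain ⟨τ, hτ, hτR, hτX⟩ := exists_smul_notMem hR hRb h0 hX hu fun t _ => hXV t
  obtain ⟨τ', hτ', hτR', hτX'⟩ := exists_smul_notMem hR hRb h0 hX (neg_ne_zero.2 hu)
    fun t _ => by
      rw [smul_neg, ← neg_smul]
      exact hXV (-t)
  have hlt : ∀ k : ℝ, segment ℝ 0 (k • u) ⊆ R → k < τ := by
    intro k hk
    by_contra! hle
    exact hτR (hk (smul_mem_segment_zero_smul hτ.le hle u))
  have hbent : ∀ (k : ℝ) (w : ℂ), IsPreconnected (segment ℝ 0 (k • u) ∪ segment ℝ (k • u) w) :=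
    fun k w => IsPreconnected.union (k • u) (right_mem_segment ℝ _ _) (left_mem_segment ℝ _ _)
      (convex_segment _ _).isPreconnected (convex_segment _ _).isPreconnected
  -- `X` joins `x` to `x'` off the visible part of the line of `u`; the path through `a • u`, `0`
  -- and `b • u` joins them and meets that line only within its visible part.
  refine not_opposite_of_isPreconnected (Y := X)
    (Q := (segment ℝ 0 (a • u) ∪ segment ℝ (a • u) x) ∪
      (segment ℝ 0 (b • u) ∪ segment ℝ (b • u) x'))
    hR hRc hu hτ hτ' hτR (by rwa [neg_smul, ← smul_neg]) hXR hXc ?_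
    (Set.union_subset (Set.union_subset hz hzx) (Set.union_subset hz' hzx')) ?_ ?_ hx hx'
    (Or.inl (Or.inr (right_mem_segment ℝ _ _))) (Or.inr (Or.inr (right_mem_segment ℝ _ _)))
    hxu hxu'
  · intro t ht1 ht2
    rcases le_total 0 t with h | h
    · exact hτX t h ht2
    · have := hτX' (-t) (by linarith) (by linarith)
      rwa [smul_neg, neg_smul, neg_neg] at this
  · exact IsPreconnected.union 0 (Or.inl (left_mem_segment ℝ _ _))
      (Or.inl (left_mem_segment ℝ _ _)) (hbent a x) (hbent b x')
  · intro t ht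
    have aux : ∀ (k : ℝ) (w : ℂ), 0 ≤ k → segment ℝ 0 (k • u) ⊆ R → planarCross u w ≠ 0 →
        t • u ∈ segment ℝ 0 (k • u) ∪ segment ℝ (k • u) w → -τ' < t ∧ t < τ := by
      intro k w hk hkR hw htw
      have hkτ := hlt k hkR
      have hinj : ∀ {r s : ℝ}, r • u = s • u → r = s := fun h => smul_left_injective ℝ hu h
      rcases htw with h | h
      · obtain ⟨l, hl0, hl1, hl⟩ := exists_smul_of_mem_segment_zero h
        rw [smul_smul] at hl
        rw [hinj hl]
        constructor <;> nlinarith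
      · obtain ⟨α, β, hα, hβ, hαβ, h⟩ := h
        have h1 : α * planarCross u (k • u) + β * planarCross u w = 0 := by
          rw [← planarCross_add_smul, h, planarCross_smul, planarCross_self, mul_zero]
        rw [planarCross_smul, planarCross_self, mul_zero, mul_zero, zero_add] at h1
        have h2 : β = 0 := (mul_eq_zero.1 h1).resolve_right hw
        have h3 : α = 1 := by linarith
        rw [h2, h3, zero_smul, add_zero, one_smul] at h
        rw [← hinj h]
        exact ⟨by linarith, hkτ⟩
    exact ht.elim (aux a x ha hz hxu.ne') (aux b x' hb hz' hxu'.ne)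

/-- A connected set that is invisible from the origin is seen by the points visible from
the origin only through a single ray from the origin and only from one side of it. -/
theorem exists_window (hR : IsClosed R) (hRb : Bornology.IsBounded R)
    (hRc : IsPreconnected Rᶜ) (h0 : 0 ∈ R) (hX : IsClosed X) (hXc : IsPreconnected X)
    (hXR : X ⊆ R) (hXv : ∀ x ∈ X, ¬ segment ℝ 0 x ⊆ R) :
    ∃ u : ℂ, u ≠ 0 ∧ ∃ s : ℝ, s ≠ 0 ∧ ∀ q x : ℂ, segment ℝ 0 q ⊆ R → x ∈ X →
      segment ℝ q x ⊆ R → (∃ t : ℝ, 0 < t ∧ t • u ∈ segment ℝ q x) ∧ 0 < s * planarCross u x := by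
  by_cases hex : ∃ q x : ℂ, segment ℝ 0 q ⊆ R ∧ x ∈ X ∧ segment ℝ q x ⊆ R
  swap
  · push Not at hex
    exact ⟨1, one_ne_zero, 1, one_ne_zero, fun q x hq hx hqx => absurd hqx (hex q x hq hx)⟩
  obtain ⟨q₀, x₀, hq₀, hx₀, hqx₀⟩ := hex
  obtain ⟨z₀, hz₀, hz₀R, hlast₀⟩ := exists_last_visible (x := x₀) hR hq₀
  have hzx₀ := (segment_subset_segment_of_mem hz₀).trans hqx₀
  have hz₀0 : z₀ ≠ 0 := by
    rintro rfl
    exact hXv x₀ hx₀ hzx₀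
  have hcr₀ : planarCross z₀ x₀ ≠ 0 := fun h =>
    hXv x₀ hx₀ (segment_zero_subset_of_cross_eq_zero hz₀R hzx₀ h)
  -- One sight line fixes the window: its last visible point gives the ray, and its end in `X` gives
  -- the side.
  refine ⟨z₀, hz₀0, planarCross z₀ x₀, hcr₀, fun q x hq hx hqx => ?_⟩
  obtain ⟨z, hz, hzR, hlast⟩ := exists_last_visible (x := x) hR hq
  have hzx := (segment_subset_segment_of_mem hz).trans hqx
  obtain ⟨c, hc, rfl⟩ := eq_smul_of_last_visible hR hRb hRc h0 hX hXc hXR hXv hx₀ hx hz₀R hzR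
    hzx₀ hzx hlast₀ hlast
  refine ⟨⟨c, hc, hz⟩, ?_⟩
  have hcr : planarCross z₀ x ≠ 0 := by
    intro h
    refine hXv x hx (segment_zero_subset_of_cross_eq_zero hzR hzx ?_)
    have : planarCross (c • z₀) x = c * planarCross z₀ x := by
      simp [planarCross]
      ring
    rw [this, h, mul_zero]
  have hone : (1 : ℝ) • z₀ = z₀ := one_smul ℝ z₀
  have hboth := fun {y y' : ℂ} {a b : ℝ} => not_seen_from_both_sides (x := y) (x' := y')
    (u := z₀) (a := a) (b := b) hR hRb hRc h0 hX hXc hXR hXv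
  rcases lt_or_gt_of_ne hcr₀ with h | h <;> rcases lt_or_gt_of_ne hcr with h' | h'
  · exact mul_pos_of_neg_of_neg h h'
  · exact (hboth hx hx₀ hc.le zero_le_one hzR (by rwa [hone]) hzx (by rwa [hone]) h' h).elim
  · exact (hboth hx₀ hx zero_le_one hc.le (by rwa [hone]) hzR (by rwa [hone]) hzx h h').elim
  · exact mul_pos h h'

end Window

/-! ### Two windows cannot block all directions. -/

section TwoTours

variable {B R X X₁ X₂ : Set ℂ}

/-- An open half-plane is convex and misses its bounding line. Hence a visible point strictly on the
side of the window where `X` is seen cannot itself see `X`. -/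
theorem not_pos_of_mem_segment {u q x : ℂ} {s t : ℝ} (h : t • u ∈ segment ℝ q x)
    (hx : 0 < s * planarCross u x) : ¬ 0 < s * planarCross u q := by
  intro hq
  obtain ⟨α, β, hα, hβ, hαβ, h⟩ := h
  have h1 : α * planarCross u q + β * planarCross u x = 0 := by
    rw [← planarCross_add_smul, h, planarCross_smul, planarCross_self, mul_zero]
  have h2 : α * (s * planarCross u q) + β * (s * planarCross u x) = 0 := by
    linear_combination s * h1
  rcases hα.eq_or_lt with rfl | hα'
  · have : β = 1 := by linarith
    rw [this] at h2
    linarith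
  · have := mul_pos hα' hq
    have := mul_nonneg hβ hx.le
    linarith

/-- The points of a compact set that see a compact set `X` across a ray from the origin and lie
close to the opposite ray force the origin to see `X`. -/
theorem exists_visible_of_forall_pos (hR : IsClosed R) (hB : IsCompact B) (hX : IsCompact X)
    {u : ℂ} (hu : u ≠ 0) {C : ℝ}
    (h : ∀ ε > 0, ∃ q ∈ B, ∃ x ∈ X, segment ℝ q x ⊆ R ∧ (∃ t : ℝ, 0 ≤ t ∧ t • u ∈ segment ℝ q x) ∧
      u.re * q.re + u.im * q.im ≤ 0 ∧ |planarCross u q| ≤ ε * C) :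
    ∃ x ∈ X, segment ℝ 0 x ⊆ R := by
  have hN : 0 < u.re * u.re + u.im * u.im := by
    simpa [Complex.normSq_apply] using Complex.normSq_pos.2 hu
  set p : ℂ × ℂ × ℝ → ℂ := fun a => a.1 + a.2.2 • (a.2.1 - a.1) with hp
  have hpc : Continuous p := by fun_prop
  -- `K` records a sight line from `q` to `x` with the parameter of its crossing point on the ray of
  -- `u`. All conditions are closed, so the distance of `q` from the line of `u` attains its
  -- minimum, which the hypothesis forces to be zero.
  set K : Set (ℂ × ℂ × ℝ) := (B ×ˢ X ×ˢ Set.Icc (0 : ℝ) 1) ∩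
    ({a | segment ℝ a.1 a.2.1 ⊆ R} ∩ {a | planarCross u (p a) = 0} ∩
      {a | 0 ≤ u.re * (p a).re + u.im * (p a).im} ∩
      {a | u.re * a.1.re + u.im * a.1.im ≤ 0}) with hKdef
  have hKc : IsCompact K := by
    refine (hB.prod (hX.prod isCompact_Icc)).inter_right
      (((IsClosed.inter ?_ ?_).inter ?_).inter ?_)
    · exact (isClosed_setOf_segment_subset hR).preimage
        (by fun_prop : Continuous fun a : ℂ × ℂ × ℝ => (a.1, a.2.1))
    · unfold planarCross
      exact isClosed_eq (by fun_prop) (by fun_prop)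
    · exact isClosed_le (by fun_prop) (by fun_prop)
    · exact isClosed_le (by fun_prop) (by fun_prop)
  have hKε : ∀ ε > 0, ∃ a ∈ K, |planarCross u a.1| ≤ ε * C := by
    intro ε hε
    obtain ⟨q, hq, x, hx, hqx, ⟨t, ht, htm⟩, hdot, hcr⟩ := h ε hε
    rw [segment_eq_image'] at htm
    obtain ⟨θ, hθ, hθt⟩ := htm
    dsimp only at hθt
    refine ⟨(q, x, θ), ⟨⟨hq, hx, hθ⟩, ⟨⟨hqx, ?_⟩, ?_⟩, hdot⟩, hcr⟩
    · simp only [Set.mem_ofPred_eq, hp]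
      rw [hθt, planarCross_smul, planarCross_self, mul_zero]
    · simp only [Set.mem_ofPred_eq, hp]
      rw [hθt]
      simp only [Complex.smul_re, Complex.smul_im, smul_eq_mul]
      nlinarith
  have hKn : K.Nonempty := by
    obtain ⟨a, ha, -⟩ := hKε 1 one_pos
    exact ⟨a, ha⟩
  obtain ⟨⟨q, x, θ⟩, ha, hmin⟩ := hKc.exists_isMinOn (f := fun a => |planarCross u a.1|) hKn
    (by unfold planarCross; fun_prop)
  have hzero : planarCross u q = 0 := by
    by_contra hne
    have hpos : 0 < |planarCross u q| := abs_pos.2 hne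
    have hC : 0 < |C| + 1 := by positivity
    obtain ⟨b, hb, hbC⟩ := hKε (|planarCross u q| / (|C| + 1)) (by positivity)
    have h1 : |planarCross u q| ≤ |planarCross u b.1| := hmin hb
    have h2 := h1.trans hbC
    rw [div_mul_eq_mul_div, le_div_iff₀ hC] at h2
    nlinarith [le_abs_self C]
  obtain ⟨⟨hqB, hxX, hθ⟩, ⟨⟨hqx, hz⟩, hzdot⟩, hqdot⟩ := ha
  simp only [Set.mem_ofPred_eq, hp] at hz hzdot hqdot hqx hxX
  have hzmem : q + θ • (x - q) ∈ segment ℝ q x := by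
    rw [segment_eq_image']
    exact ⟨θ, hθ, rfl⟩
  obtain ⟨a, ha⟩ := eq_smul_of_cross_eq_zero hu hzero
  obtain ⟨b, hb⟩ := eq_smul_of_cross_eq_zero hu hz
  rw [hb] at hzdot hzmem
  rw [ha] at hqdot
  simp only [Complex.smul_re, Complex.smul_im, smul_eq_mul] at hzdot hqdot
  have ha0 : a ≤ 0 := by
    by_contra! h
    nlinarith [mul_pos h hN]
  have hb0 : 0 ≤ b := by
    by_contra! h
    nlinarith [mul_pos (neg_pos.2 h) hN]
  -- The minimizing `q` lies at or behind the origin on the line of `u`, its crossing point at or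
  -- ahead of it, so the sight line contains the origin.
  have hmem : (0 : ℂ) ∈ segment ℝ q x := by
    have h1 : (0 : ℝ) • u ∈ segment ℝ (a • u) (b • u) :=
      smul_mem_segment_smul (by rw [Set.uIcc_of_le (ha0.trans hb0)]; exact ⟨ha0, hb0⟩) u
    rw [zero_smul, ← ha] at h1
    exact (convex_segment q x).segment_subset (left_mem_segment ℝ q x) hzmem h1
  exact ⟨x, hxX, (segment_subset_segment_of_mem hmem).trans hqx⟩

/-- If every ray from the origin ends at a visible point of `B` and every point of `B` sees one of
two compact connected sets, then so does the origin. -/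
theorem exists_visible_of_forall_mem (hR : IsClosed R) (hRb : Bornology.IsBounded R)
    (hRc : IsPreconnected Rᶜ) (h0 : 0 ∈ R) (hB : IsCompact B)
    (hray : ∀ d : ℂ, d ≠ 0 → ∃ t : ℝ, 0 < t ∧ t • d ∈ B ∧ segment ℝ 0 (t • d) ⊆ R)
    (hX₁ : IsCompact X₁) (hX₁c : IsPreconnected X₁) (hX₁R : X₁ ⊆ R)
    (hX₂ : IsCompact X₂) (hX₂c : IsPreconnected X₂) (hX₂R : X₂ ⊆ R)
    (hsee : ∀ q ∈ B, (∃ x ∈ X₁, segment ℝ q x ⊆ R) ∨ ∃ x ∈ X₂, segment ℝ q x ⊆ R) :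
    (∃ x ∈ X₁, segment ℝ 0 x ⊆ R) ∨ ∃ x ∈ X₂, segment ℝ 0 x ⊆ R := by
  by_contra hcon
  rw [not_or] at hcon
  obtain ⟨hv₁, hv₂⟩ := hcon
  obtain ⟨u₁, hu₁, s₁, hs₁, hw₁⟩ := exists_window hR hRb hRc h0 hX₁.isClosed hX₁c hX₁R
    fun x hx h => hv₁ ⟨x, hx, h⟩
  obtain ⟨u₂, hu₂, s₂, hs₂, hw₂⟩ := exists_window hR hRb hRc h0 hX₂.isClosed hX₂c hX₂R
    fun x hx h => hv₂ ⟨x, hx, h⟩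
  have hsees₂ : ∀ q ∈ B, segment ℝ 0 q ⊆ R → 0 < s₁ * planarCross u₁ q →
      ∃ x ∈ X₂, segment ℝ q x ⊆ R := by
    intro q hq hqR hpos
    refine (hsee q hq).resolve_left ?_
    rintro ⟨x, hx, hqx⟩
    obtain ⟨⟨t, -, ht⟩, hxs⟩ := hw₁ q x hqR hx hqx
    exact not_pos_of_mem_segment ht hxs hpos
  by_cases hc : planarCross u₁ u₂ = 0
  · obtain ⟨c, rfl⟩ := eq_smul_of_cross_eq_zero hu₁ hc
    have hc0 : c ≠ 0 := by
      rintro rfl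
      simp at hu₂
    set N : ℝ := u₁.re * u₁.re + u₁.im * u₁.im with hNdef
    have hN : 0 < N := by
      simpa [Complex.normSq_apply] using Complex.normSq_pos.2 hu₁
    obtain ⟨M, hM⟩ := (hB.image (f := fun q : ℂ => |u₁.re * q.re + u₁.im * q.im|)
      (by fun_prop)).bddAbove
    refine hv₂ (exists_visible_of_forall_pos hR hB hX₂ hu₂ (C := |s₁| * M) fun ε hε => ?_)
    -- The direction opposite to the second window, tilted by `ε` into the open half-plane from
    -- which `X₁` is not seen. The sign of `c` does not matter.
    set d : ℂ := -(c • u₁) + (ε * s₁) • ⟨-u₁.im, u₁.re⟩ with hd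
    have hdre : d.re = -(c * u₁.re) + ε * s₁ * -u₁.im := by simp [hd]
    have hdim : d.im = -(c * u₁.im) + ε * s₁ * u₁.re := by simp [hd]
    have hcd : planarCross u₁ d = ε * s₁ * N := by
      simp only [planarCross, hdre, hdim, hNdef]
      ring
    have hdd : u₁.re * d.re + u₁.im * d.im = -(c * N) := by
      simp only [hdre, hdim, hNdef]
      ring
    have hd0 : d ≠ 0 := by
      intro h
      rw [h] at hdd
      simp at hdd
      rcases hdd with h | h
      · exact hc0 h
      · exact hN.ne' h
    obtain ⟨t, ht, htB, htR⟩ := hray d hd0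
    obtain ⟨x, hx, hqx⟩ := hsees₂ (t • d) htB htR (by
      rw [planarCross_smul, hcd]
      have : 0 < s₁ * s₁ := mul_self_pos.2 hs₁
      have : 0 < (s₁ * s₁) * (t * ε * N) := by positivity
      linarith)
    obtain ⟨⟨r, hr, hrm⟩, -⟩ := hw₂ _ x htR hx hqx
    refine ⟨t • d, htB, x, hx, hqx, ⟨r, hr.le, hrm⟩, ?_, ?_⟩
    · have : (c • u₁).re * (t • d).re + (c • u₁).im * (t • d).im = -(t * (c * c) * N) := by
        simp only [Complex.smul_re, Complex.smul_im, smul_eq_mul]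
        linear_combination c * t * hdd
      rw [this, neg_nonpos]
      exact mul_nonneg (mul_nonneg ht.le (mul_self_nonneg c)) hN.le
    -- The length `t` is not controlled directly, but `t * c * N` is, up to sign, the inner product
    -- of `u₁` with a point of `B`, hence bounded by `M`.
    · have h1 : |u₁.re * (t • d).re + u₁.im * (t • d).im| ≤ M :=
        hM ⟨t • d, htB, rfl⟩
      have h2 : u₁.re * (t • d).re + u₁.im * (t • d).im = -(t * c * N) := by
        simp only [Complex.smul_re, Complex.smul_im, smul_eq_mul]
        linear_combination t * hdd
      have h3 : planarCross (c • u₁) (t • d) = ε * s₁ * (t * c * N) := by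
        rw [planarCross_smul]
        have : planarCross (c • u₁) d = c * planarCross u₁ d := by
          simp only [planarCross, Complex.smul_re, Complex.smul_im, smul_eq_mul]
          ring
        rw [this, hcd]
        ring
      rw [h2, abs_neg] at h1
      rw [h3, abs_mul, abs_mul, abs_of_pos hε, mul_assoc]
      gcongr
  -- The coefficients solve `planarCross uᵢ d = sᵢ * (planarCross u₁ u₂) ^ 2` for both `i`, which
  -- puts `d` in both forbidden open half-planes.
  · set d : ℂ := (-(s₂ * planarCross u₁ u₂)) • u₁ + (s₁ * planarCross u₁ u₂) • u₂ with hd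
    have hc2 : 0 < planarCross u₁ u₂ * planarCross u₁ u₂ := mul_self_pos.2 hc
    have hanti : planarCross u₂ u₁ = - planarCross u₁ u₂ := by
      simp only [planarCross]
      ring
    have hd₁ : planarCross u₁ d = s₁ * (planarCross u₁ u₂ * planarCross u₁ u₂) := by
      rw [hd, planarCross_add_smul, planarCross_self]
      ring
    have hd₂ : planarCross u₂ d = s₂ * (planarCross u₁ u₂ * planarCross u₁ u₂) := by
      rw [hd, planarCross_add_smul, planarCross_self, hanti]
      ring
    have hd0 : d ≠ 0 := by
      intro h
      rw [h] at hd₁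
      have h1 : s₁ * (planarCross u₁ u₂ * planarCross u₁ u₂) = 0 := by
        rw [← hd₁]
        simp [planarCross]
      exact (mul_ne_zero hs₁ hc2.ne') h1
    have hpos : ∀ {s t : ℝ}, s ≠ 0 → 0 < t →
        0 < s * (t * (s * (planarCross u₁ u₂ * planarCross u₁ u₂))) := by
      intro s t hs ht
      have : 0 < s * s := mul_self_pos.2 hs
      have : 0 < (s * s) * (t * (planarCross u₁ u₂ * planarCross u₁ u₂)) := by positivity
      linarith
    obtain ⟨t, ht, htB, htR⟩ := hray d hd0
    obtain ⟨x, hx, hqx⟩ := hsees₂ (t • d) htB htR (by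
      rw [planarCross_smul, hd₁]
      exact hpos hs₁ ht)
    obtain ⟨⟨r, -, hrm⟩, hxs⟩ := hw₂ _ x htR hx hqx
    refine not_pos_of_mem_segment hrm hxs ?_
    rw [planarCross_smul, hd₂]
    exact hpos hs₂ ht

end TwoTours

/-! ### Application to polygons. -/

theorem Polygon.isCompact_boundary {n : ℕ} (P : Polygon Plane n) : IsCompact (P.boundary ℝ) := by
  refine isCompact_iUnion fun i => ?_
  rw [Polygon.edgeSet_eq_image_edgePath]
  exact isCompact_Icc.image (AffineMap.continuous_of_finiteDimensional _)

theorem Polygon.sees_iff {n : ℕ} {P : Polygon Plane n} {x y : Plane} :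
    P.Sees x y ↔ segment ℝ x y ⊆ P.region := by
  rw [Polygon.Sees, Polygon.exterior, Set.disjoint_compl_right_iff_subset]
  exact ⟨fun h => h.2.2, fun h => ⟨h (left_mem_segment ℝ x y), h (right_mem_segment ℝ x y), h⟩⟩

/-- Simplicity of the chain is not needed: the argument uses only that the region is the boundary
filled in, so that its complement is connected. -/
theorem mainTheorem4 {n : ℕ} (P : Polygon Plane n) (hP : P.IsSimple)
    {a b : Plane} (X₁ : Path a a) (X₂ : Path b b)
    (hX₁ : Set.range X₁ ⊆ P.region) (hX₂ : Set.range X₂ ⊆ P.region)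
    (hsee : P.boundary ℝ ⊆ P.visibility (Set.range X₁) ∪ P.visibility (Set.range X₂)) :
    P.visibility (Set.range X₁) ∪ P.visibility (Set.range X₂) = P.region := by
  refine Set.Subset.antisymm (Set.union_subset (fun x hx => hx.1) fun x hx => hx.1) ?_
  intro p hp
  by_cases hpB : p ∈ P.boundary ℝ
  · exact hsee hpB
  have hBc := P.isCompact_boundary
  have hRcl : IsClosed P.region := isClosed_filling hBc.isClosed
  have hRb : Bornology.IsBounded P.region := isBounded_filling hBc.isBounded
  have hrank : 1 < Module.rank ℝ Plane := by
    rw [← Module.finrank_eq_rank]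
    simp
  have hRcc : IsPreconnected P.regionᶜ := isPreconnected_compl_filling hrank hBc.isBounded
  -- This isometry identifies the plane with `ℂ` and sends the origin to `p`; being affine and a
  -- homeomorphism, it transports segments, compactness and connectedness.
  let φ : ℂ ≃ᵃⁱ[ℝ] Plane := Complex.orthonormalBasisOneI.repr.toAffineIsometryEquiv.trans
    (AffineIsometryEquiv.vaddConst ℝ p)
  have hφ0 : φ 0 = p := by simp [φ]
  have hφs : ∀ (t : ℝ) (d : ℂ), φ (t • d) = p + t • (φ d - p) := by
    intro t d
    simp only [φ, AffineIsometryEquiv.coe_trans, Function.comp_apply,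
      LinearIsometryEquiv.coe_toAffineIsometryEquiv, AffineIsometryEquiv.coe_vaddConst, map_smul,
      vadd_eq_add, add_sub_cancel_right]
    rw [add_comm]
  have hseg : ∀ {S : Set Plane} {x y : ℂ},
      segment ℝ x y ⊆ φ ⁻¹' S ↔ segment ℝ (φ x) (φ y) ⊆ S := by
    intro S x y
    rw [← Set.image_subset_iff, ← AffineIsometryEquiv.coe_toAffineEquiv,
      ← AffineEquiv.coe_toAffineMap, image_segment]
  have hpre : ∀ {S : Set Plane}, IsCompact S → IsCompact (φ ⁻¹' S) := fun h =>
    φ.toHomeomorph.isCompact_preimage.2 h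
  have hprec : ∀ {S : Set Plane}, IsPreconnected S → IsPreconnected (φ ⁻¹' S) := fun h =>
    φ.toHomeomorph.isPreconnected_preimage.2 h
  have hRk : IsCompact P.region := Metric.isCompact_of_isClosed_isBounded hRcl hRb
  have hex : ∀ {X : Set Plane} {c : ℂ}, (∃ x ∈ φ ⁻¹' X, segment ℝ c x ⊆ φ ⁻¹' P.region) ↔
      ∃ y ∈ X, P.Sees (φ c) y := by
    intro X c
    simp only [Polygon.sees_iff, hseg]
    constructor
    · rintro ⟨x, hx, h⟩
      exact ⟨φ x, hx, h⟩
    · rintro ⟨y, hy, h⟩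
      exact ⟨φ.symm y, by simpa using hy, by simpa using h⟩
  have main := exists_visible_of_forall_mem (B := φ ⁻¹' P.boundary ℝ) (R := φ ⁻¹' P.region)
    (X₁ := φ ⁻¹' Set.range X₁) (X₂ := φ ⁻¹' Set.range X₂)
    (hpre hRk).isClosed (hpre hRk).isBounded (hprec hRcc) (by simpa [hφ0] using hp) (hpre hBc)
    (fun d hd => ?_)
    (hpre (isCompact_range X₁.continuous)) (hprec (isPreconnected_range X₁.continuous))
    (Set.preimage_mono hX₁)
    (hpre (isCompact_range X₂.continuous)) (hprec (isPreconnected_range X₂.continuous))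
    (Set.preimage_mono hX₂)
    (fun q hq => (hsee hq).imp (fun h => hex.2 h.2) (fun h => hex.2 h.2))
  · rw [hex, hex, hφ0] at main
    exact main.imp (fun h => ⟨hp, h⟩) (fun h => ⟨hp, h⟩)
  · have hd' : φ d - p ≠ 0 := by
      rw [← hφ0, sub_ne_zero]
      exact φ.injective.ne hd
    obtain ⟨t, ht, htB, htR⟩ := exists_smul_mem_of_mem_filling hBc.isClosed hp hpB hd'
    refine ⟨t, ht, ?_, ?_⟩
    · rw [Set.mem_preimage, hφs]
      exact htB
    · rw [hseg, hφ0, hφs]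
      exact htR
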